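/- **Incompleteness theorem for $\Omega$.** Programs and outputs are finite bit strings. A *self-delimiting computer* is a partial computable function $C$ from bit strings to bit strings whose domain is prefix-free, and $H_C(x)=\min\{|p| : C(p)=x\}$ (with $\min\emptyset=\infty$). Let $U$ be a computer, given by a computable transition system, that reads its program one bit at a time, asking for each bit itself, that may display strings during its computation, and that may halt with an output. Write $U(p)=x$ if $U$, run on $p$, halts with output $x$ after reading all of $p$ without asking for a further bit. Assume that $U$ is universal: for every self-delimiting computer $C$ there is a constant $c_C$ with $H_U(x)\le H_C(x)+c_C$ for all $x$. Let $$\Omega=\sum_{U(p)\text{ halts}}2^{-|p|}$$ be its halting probability. A program $p$ *enumerates* a set $T$ of strings if the (possibly unending) computation of $U$ on $p$ reads all of $p$, never asks for a bit beyond its end, and displays exactly the elements of $T$. The *complexity* of a formal theory with set of theorems $T$ is the length of the shortest program that enumerates $T$. Fix a formal language whose sentences are bit strings, with a notion of truth, in which for all $k$ and $b\in\{0,1\}$ there is a sentence $\sigma_{k,b}$, computable from $k$ and $b$, that is true if and only if the $k$-th bit after the binary point in the base-two expansion of $\Omega$ is $b$. Then there is a constant $c$ such that for every $N$ and every formal theory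 $T$ of complexity $N$ in this language all of whose theorems are true, there are at most $N+c$ positions $k$, consecutive or not, for which $T$ determines the $k$-th bit of $\Omega$, that is, contains $\sigma_{k,0}$ or $\sigma_{k,1}$. -/

import Mathlib

/-- A computer that reads its binary program one bit at a time and itself decides when to ask for
the next bit. Configurations are coded by natural numbers, outputs by finite bit strings; every
part of the description is computable.
* In a configuration `s` with `result s = some x` the computer has halted with output `x`.
* Otherwise, if `reads s`, it asks for the next program bit `b` and goes to `next s (some b)`.
* Otherwise it goes to `next s none`, without looking at its program.
* In a configuration `s` with `display s = some x` it displays the string `x`; thus a computation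
  that never halts can still produce an infinite set of outputs. -/
structure BitComputer where
  start : ℕ
  reads : ℕ → Bool
  next : ℕ → Option Bool → ℕ
  display : ℕ → Option (List Bool)
  result : ℕ → Option (List Bool)
  computable_reads : Computable reads
  computable_next : Computable₂ next
  computable_display : Computable display
  computable_result : Computable result

/-- A self-delimiting computer, abstractly: a partial computable function on bit strings such that
no proper extension of a valid program is a valid program. -/
structure IsSelfDelimiting (C : List Bool →. List Bool) : Prop where
  partrec : Partrec C
  prefixFree : ∀ p q, p ∈ C.Dom → q ∈ C.Dom → p <+: q → p = q

/-- Program-size complexity: the length of a shortest `p` with `C p = x` (`⊤` if there is none). -/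
noncomputable def complexity (C : List Bool →. List Bool) (x : List Bool) : ℕ∞ :=
  ⨅ (p : List Bool) (_ : x ∈ C p), (p.length : ℕ∞)

namespace BitComputer

variable (U : BitComputer)

/-- One step from a configuration together with the still unread part of the program;
`none` means that the computer ran off the end of its program. -/
def step : ℕ × List Bool → Option (ℕ × List Bool)
  | (s, w) =>
    if (U.result s).isSome then some (s, w)
    else if U.reads s then
      match w with
      | [] => none
      | b :: w' => some (U.next s (some b), w')
    else some (U.next s none, w)

/-- The situation after `n` steps on the program `p`. -/
def run (p : List Bool) : ℕ → Option (ℕ × List Bool)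
  | 0 => some (U.start, p)
  | n + 1 => (run p n).bind U.step

/-- The output at time `n`, if the computer has halted by then after reading exactly `p`. -/
def outputAt (p : List Bool) (n : ℕ) : Option (List Bool) :=
  (U.run p n).bind fun c => if c.2 = [] then U.result c.1 else none

/-- The function computed by halting computations: `U.eval p` is defined, with value `x`, iff the
computer on program `p` halts with output `x` after reading all of `p` and nothing beyond. -/
def eval : List Bool →. List Bool := fun p => Nat.rfindOpt (U.outputAt p)

/-- On program `p` the computer at some time displays `x`. -/
def Displays (p x : List Bool) : Prop :=
  ∃ n s w, U.run p n = some (s, w) ∧ U.display s = some x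

/-- `p` is a self-delimiting program enumerating the set `T`: the (usually unending) computation
on `p` reads all of `p`, never tries to read beyond it, and displays exactly the elements
of `T`. -/
def Enumerates (p : List Bool) (T : Set (List Bool)) : Prop :=
  (∀ n, U.run p n ≠ none) ∧ (∃ n s, U.run p n = some (s, [])) ∧ ∀ x, U.Displays p x ↔ x ∈ T

/-- The complexity of a formal theory with set of theorems `T`: the length of a shortest
self-delimiting program enumerating `T` (`⊤` if there is none). -/
noncomputable def theoryComplexity (T : Set (List Bool)) : ℕ∞ :=
  ⨅ (p : List Bool) (_ : U.Enumerates p T), (p.length : ℕ∞)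

/-- `U` is universal: up to an additive constant, its programs are no longer than those of any
self-delimiting computer. -/
def IsUniversal : Prop :=
  ∀ C : List Bool →. List Bool, IsSelfDelimiting C →
    ∃ c : ℕ, ∀ x, complexity U.eval x ≤ complexity C x + c

/-- The halting probability of `U`. -/
noncomputable def omega : ℝ :=
  ∑' p : {p : List Bool // (U.eval p).Dom}, (1 / 2 : ℝ) ^ p.1.length

end BitComputer

/-! Berry's paradox against `U`. Suppose a program `p` displays true sentences that settle many more
bits of `Ω` than `p` has itself. Run it for `s` steps, during which it reads a prefix `q`, and let
`m` positions below `s` be settled by then. Then `q` and the `s - m` missing bits determine the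
first `s` bits of `Ω`, and `|q| + s - m` is well below `s`. These bits decide halting for all
programs shorter than `s`: once `omegaAt t` is within `2 ^ (1 - s)` of `Ω`, such a program not found
by stage `t` never halts. A string different from all outputs found so far thus has complexity at
least `s` (`le_complexity_freshString`), although it was computed from a shorter input.

The computation is done by `diagonal`. It is self-delimiting (`diagonal_prefixFree`) because the run
on `q` fixes `s` and `m`, hence the number of bits still to follow. Universality costs a constant
`c` that depends on `diagonal`, so `c` cannot be built in and is supplied with the input as `1 ^ c
0`. A short input exists as soon as `m` is at least `|q| + 2 * c + 2` (`exists_mem_diagonal`), and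
`Enumerates.exists_surplus` shows that this happens. -/

open Encodable

/-! ### Kraft's inequality. -/

namespace InformationTheory

/-- A prefix-free code without the empty word is uniquely decodable. -/
theorem UniquelyDecodable.of_prefixFree {α : Type*} {S : Set (List α)} (hnil : [] ∉ S)
    (hS : ∀ p ∈ S, ∀ q ∈ S, p <+: q → p = q) : UniquelyDecodable S := by
  intro L₁
  induction L₁ with
  | nil =>
    intro L₂ _ h₂ h
    cases L₂ with
    | nil => rfl
    | cons q L₂ =>
      have hq : q = [] := by
        have := h.symm
        simp only [List.flatten_nil, List.flatten_cons, List.append_eq_nil_iff] at this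
        exact this.1
      exact absurd (hq ▸ h₂ q (by simp)) hnil
  | cons p L₁ ih =>
    intro L₂ h₁ h₂ h
    cases L₂ with
    | nil =>
      have hp : p = [] := by
        simp only [List.flatten_nil, List.flatten_cons, List.append_eq_nil_iff] at h
        exact h.1
      exact absurd (hp ▸ h₁ p (by simp)) hnil
    | cons q L₂ =>
      simp only [List.flatten_cons] at h
      have hp := h₁ p (by simp)
      have hq := h₂ q (by simp)
      have hpq : p = q := by
        have h1 : p <+: q ++ L₂.flatten := h ▸ List.prefix_append p _
        rcases List.prefix_or_prefix_of_prefix h1 (List.prefix_append q _) with h' | h'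
        · exact hS p hp q hq h'
        · exact (hS q hq p hp h').symm
      subst hpq
      rw [ih L₂ (fun w hw => h₁ w (by simp [hw])) (fun w hw => h₂ w (by simp [hw]))
        (List.append_cancel_left h)]

/-- Kraft's inequality for finite prefix-free sets of bit strings. -/
theorem kraft_of_prefixFree {S : Finset (List Bool)}
    (hS : ∀ p ∈ S, ∀ q ∈ S, p <+: q → p = q) : ∑ p ∈ S, (1 / 2 : ℝ) ^ p.length ≤ 1 := by
  -- A code containing the empty word is not uniquely decodable, but prefix-freeness then leaves it
  -- no other word.
  by_cases hnil : [] ∈ S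
  · have : S = {[]} := by
      ext q
      simp only [Finset.mem_singleton]
      exact ⟨fun hq => (hS [] hnil q hq List.nil_prefix).symm, fun hq => hq ▸ hnil⟩
    simp [this]
  · have := kraft_mcmillan_inequality (S := S)
      (UniquelyDecodable.of_prefixFree (by simpa using hnil) (by simpa using hS))
    simpa using this

end InformationTheory

/-! ### Computations and approximation of the halting probability from below. -/

namespace BitComputer

variable (U : BitComputer)

theorem run_succ (p : List Bool) (n : ℕ) : U.run p (n + 1) = (U.run p n).bind U.step := rfl

/-- A halted computation stays where it is. -/
theorem run_of_result {p w : List Bool} {m n σ : ℕ} (h : U.run p m = some (σ, w))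
    (hσ : (U.result σ).isSome) (hmn : m ≤ n) : U.run p n = some (σ, w) := by
  induction n, hmn using Nat.le_induction with
  | base => exact h
  | succ n _ ih => simp [run_succ, ih, step, hσ]

/-- A computation depends only on the part of the program read so far. -/
theorem exists_read_prefix {q rest : List Bool} {s σ : ℕ} (h : U.run q s = some (σ, rest)) :
    ∃ p, q = p ++ rest ∧ (∀ r, U.run (p ++ r) s = some (σ, r)) ∧
      ∀ i ≤ s, ∃ τ u, ∀ r, U.run (p ++ r) i = some (τ, u ++ r) := by
  induction s generalizing σ rest with
  | zero =>
    simp only [run, Option.some.injEq, Prod.mk.injEq] at h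
    obtain ⟨rfl, rfl⟩ := h
    refine ⟨[], rfl, fun r => rfl, fun i hi => ⟨U.start, [], fun r => ?_⟩⟩
    obtain rfl : i = 0 := by omega
    rfl
  | succ s ih =>
    rw [run_succ, Option.bind_eq_some_iff] at h
    obtain ⟨⟨σ', rest'⟩, h', hstep⟩ := h
    obtain ⟨p, hq, hs, hi⟩ := ih h'
    simp only [step] at hstep
    -- it is enough to describe the last step, after which `b` has been appended to the prefix
    suffices H : ∃ b, rest' = b ++ rest ∧ ∀ r, U.step (σ', b ++ r) = some (σ, r) by
      obtain ⟨b, hb, H⟩ := H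
      have hlast : ∀ r, U.run (p ++ b ++ r) (s + 1) = some (σ, r) := fun r => by
        rw [run_succ, List.append_assoc, hs, Option.bind_some, H]
      refine ⟨p ++ b, by rw [hq, hb, List.append_assoc], hlast, fun i his => ?_⟩
      rcases Nat.lt_or_ge s i with his' | his'
      · obtain rfl : i = s + 1 := by omega
        exact ⟨σ, [], fun r => by simpa using hlast r⟩
      · obtain ⟨τ, u, hu⟩ := hi i his'
        exact ⟨τ, u ++ b, fun r => by rw [List.append_assoc, hu, List.append_assoc]⟩
    split_ifs at hstep with h1 h2
    · simp only [Option.some.injEq, Prod.mk.injEq] at hstep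
      obtain ⟨rfl, rfl⟩ := hstep
      exact ⟨[], rfl, fun r => by simp [step, h1]⟩
    · cases rest' with
      | nil => simp at hstep
      | cons b rest' =>
        simp only [Option.some.injEq, Prod.mk.injEq] at hstep
        obtain ⟨rfl, rfl⟩ := hstep
        exact ⟨[b], rfl, fun r => by simp [step, h1, h2]⟩
    · simp only [Option.some.injEq, Prod.mk.injEq] at hstep
      obtain ⟨rfl, rfl⟩ := hstep
      exact ⟨[], rfl, fun r => by simp [step, h1, h2]⟩

theorem outputAt_eq_some {p x : List Bool} {n : ℕ} :
    U.outputAt p n = some x ↔ ∃ σ, U.run p n = some (σ, []) ∧ U.result σ = some x := by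
  constructor
  · intro h
    rw [outputAt, Option.bind_eq_some_iff] at h
    obtain ⟨⟨σ, w⟩, h1, h2⟩ := h
    simp only [Option.ite_none_right_eq_some] at h2
    obtain ⟨rfl, h2⟩ := h2
    exact ⟨σ, h1, h2⟩
  · rintro ⟨σ, h1, h2⟩
    simp [outputAt, h1, h2]

theorem outputAt_mono {p x : List Bool} {m n : ℕ} (hmn : m ≤ n) (h : U.outputAt p m = some x) :
    U.outputAt p n = some x := by
  rw [outputAt_eq_some] at h ⊢
  obtain ⟨σ, h1, h2⟩ := h
  exact ⟨σ, U.run_of_result h1 (by simp [h2]) hmn, h2⟩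

theorem mem_eval {p x : List Bool} : x ∈ U.eval p ↔ ∃ n, U.outputAt p n = some x :=
  Nat.rfindOpt_mono fun hmn h => U.outputAt_mono hmn h

theorem eval_dom {p : List Bool} : (U.eval p).Dom ↔ ∃ n, (U.outputAt p n).isSome := by
  simp only [eval, Nat.rfindOpt_dom, Option.isSome_iff_exists, Option.mem_def]

/-- If `q = p ++ r`, the computation on `q` halts as on `p`, with `r` unread. Since it stays there,
and on a valid program nothing remains unread, `r` is empty. -/
theorem eval_prefixFree {p q : List Bool} (hp : (U.eval p).Dom) (hq : (U.eval q).Dom)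
    (hpq : p <+: q) : p = q := by
  simp only [eval_dom, Option.isSome_iff_exists, outputAt_eq_some] at hp hq
  obtain ⟨m, x, σ, hm, hx⟩ := hp
  obtain ⟨n, y, τ, hn, hy⟩ := hq
  obtain ⟨r, rfl⟩ := hpq
  obtain ⟨p', hp', h, -⟩ := U.exists_read_prefix hm
  rw [List.append_nil] at hp'
  subst hp'
  have h1 := U.run_of_result (h r) (by simp [hx]) (le_max_left m n)
  have h2 := U.run_of_result hn (by simp [hy]) (le_max_right m n)
  rw [h1] at h2
  simp only [Option.some.injEq, Prod.mk.injEq] at h2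
  simp [h2.2]

theorem summable_omega :
    Summable fun p : {p : List Bool // (U.eval p).Dom} => (1 / 2 : ℝ) ^ p.1.length := by
  refine summable_of_sum_le (c := 1) (fun p => by positivity) fun F => ?_
  refine (Finset.sum_map F (Function.Embedding.subtype _)
    fun p => (1 / 2 : ℝ) ^ p.length).symm.trans_le ?_
  refine InformationTheory.kraft_of_prefixFree fun p hp q hq => ?_
  simp only [Finset.mem_map, Function.Embedding.subtype_apply, Subtype.exists] at hp hq
  obtain ⟨_, hp, -, rfl⟩ := hp
  obtain ⟨_, hq, -, rfl⟩ := hq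
  exact U.eval_prefixFree hp hq

/-- The programs with code below `t` that halt within `t` steps. -/
def haltedBy (t : ℕ) : Set (List Bool) :=
  {p | encode p < t ∧ (U.outputAt p t).isSome}

theorem haltedBy_finite (t : ℕ) : (U.haltedBy t).Finite :=
  ((Set.finite_lt_nat t).preimage encode_injective.injOn).subset fun _ hp => hp.1

/-- The approximation of the halting probability at stage `t`. -/
noncomputable def omegaAt (t : ℕ) : ℝ :=
  ∑ p ∈ (U.haltedBy_finite t).toFinset, (1 / 2 : ℝ) ^ p.length

theorem sum_le_omega (F : Finset (List Bool)) (hF : ∀ p ∈ F, (U.eval p).Dom) :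
    ∑ p ∈ F, (1 / 2 : ℝ) ^ p.length ≤ U.omega := by
  classical
  rw [← Finset.sum_subtype_of_mem (p := fun p => (U.eval p).Dom)
    (fun p : List Bool => (1 / 2 : ℝ) ^ p.length) hF]
  exact U.summable_omega.sum_le_tsum _ fun p _ => by positivity

/-- A halting program not found at stage `t` is still missing from the approximation. -/
theorem omegaAt_add_le {t : ℕ} {q : List Bool} (hq : (U.eval q).Dom) (hqt : q ∉ U.haltedBy t) :
    U.omegaAt t + (1 / 2 : ℝ) ^ q.length ≤ U.omega := by
  classical
  have := U.sum_le_omega (insert q (U.haltedBy_finite t).toFinset) fun p hp => by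
    rcases Finset.mem_insert.1 hp with rfl | hp
    · exact hq
    · exact U.eval_dom.2 ⟨t, ((U.haltedBy_finite t).mem_toFinset.1 hp).2⟩
  rwa [Finset.sum_insert (by simpa using hqt), add_comm] at this

/-- Finitely many halting programs carry all but `ε` of the sum; a stage beyond their codes and
halting times has found them all. -/
theorem exists_lt_omegaAt {ε : ℝ} (hε : 0 < ε) : ∃ t, U.omega < U.omegaAt t + ε := by
  have h := U.summable_omega.hasSum.eventually (lt_mem_nhds (sub_lt_self _ hε))
  obtain ⟨F, hF⟩ := h.exists
  choose n hn using fun p : {p : List Bool // (U.eval p).Dom} => U.eval_dom.1 p.2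
  refine ⟨F.sup fun p => max (encode p.1 + 1) (n p), ?_⟩
  rw [← sub_lt_iff_lt_add]
  refine lt_of_lt_of_le hF ?_
  refine (Finset.sum_map F (Function.Embedding.subtype _)
    fun p => (1 / 2 : ℝ) ^ p.length).symm.trans_le ?_
  refine Finset.sum_le_sum_of_subset_of_nonneg (fun p hp => ?_) fun _ _ _ => by positivity
  simp only [Finset.mem_map, Function.Embedding.subtype_apply] at hp
  obtain ⟨p, hp, rfl⟩ := hp
  have hle := Finset.le_sup (f := fun p : {p : List Bool // (U.eval p).Dom} =>
    max (encode p.1 + 1) (n p)) hp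
  rw [Set.Finite.mem_toFinset]
  refine ⟨(le_max_left _ _).trans hle, ?_⟩
  obtain ⟨x, hx⟩ := Option.isSome_iff_exists.1 (hn p)
  rw [U.outputAt_mono ((le_max_right _ _).trans hle) hx]
  rfl

end BitComputer

/-! ### Closure properties of computable functions. -/

namespace Computable

variable {α β : Type*} [Primcodable α] [Primcodable β]

theorem sum_range {f : α → ℕ} {g : α → ℕ → ℕ} (hf : Computable f) (hg : Computable₂ g) :
    Computable fun a => ∑ i ∈ Finset.range (f a), g a i := by
  have hstep : Computable₂ fun (a : α) (q : ℕ × ℕ) => q.2 + g a q.1 :=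
    Primrec.nat_add.to_comp.comp (snd.comp snd) (hg.comp fst (fst.comp snd))
  refine (nat_rec hf (const 0) hstep).of_eq fun a => ?_
  induction f a with
  | zero => rfl
  | succ n ih => rw [Finset.sum_range_succ, ← ih]

theorem nat_add {f g : α → ℕ} (hf : Computable f) (hg : Computable g) :
    Computable fun a => f a + g a := Primrec.nat_add.to_comp.comp hf hg

theorem nat_sub {f g : α → ℕ} (hf : Computable f) (hg : Computable g) :
    Computable fun a => f a - g a := Primrec.nat_sub.to_comp.comp hf hg

theorem nat_mul {f g : α → ℕ} (hf : Computable f) (hg : Computable g) :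
    Computable fun a => f a * g a := Primrec.nat_mul.to_comp.comp hf hg

theorem two_pow {f : α → ℕ} (hf : Computable f) : Computable fun a => 2 ^ f a := by
  have hstep : Computable₂ fun (_ : α) (q : ℕ × ℕ) => q.2 * 2 :=
    nat_mul (snd.comp snd) (const 2)
  refine (nat_rec hf (const 1) hstep).of_eq fun a => ?_
  induction f a with
  | zero => rfl
  | succ n ih => rw [pow_succ, ← ih]

theorem list_replicate {f : α → ℕ} (hf : Computable f) (b : β) :
    Computable fun a => List.replicate (f a) b := by
  have hstep : Computable₂ fun (_ : α) (q : ℕ × List β) => b :: q.2 :=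
    list_cons.comp (const b) (snd.comp snd)
  refine (nat_rec hf (const []) hstep).of_eq fun a => ?_
  induction f a with
  | zero => rfl
  | succ n ih => rw [List.replicate_succ, ← ih]

theorem decide_eq [DecidableEq β] {f g : α → β} (hf : Computable f) (hg : Computable g) :
    Computable fun a => decide (f a = g a) := Primrec.eq.decide.to_comp.comp hf hg

theorem decide_lt {f g : α → ℕ} (hf : Computable f) (hg : Computable g) :
    Computable fun a => decide (f a < g a) := Primrec.nat_lt.decide.to_comp.comp hf hg

theorem decide_le {f g : α → ℕ} (hf : Computable f) (hg : Computable g) :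
    Computable fun a => decide (f a ≤ g a) := Primrec.nat_le.decide.to_comp.comp hf hg

theorem bool_and {f g : α → Bool} (hf : Computable f) (hg : Computable g) :
    Computable fun a => f a && g a := Primrec.and.to_comp.comp hf hg

end Computable

/-- Complete a binary expansion: starting from the integer part `a`, append `s` binary digits, the
`k`-th one being `d k` where this is defined and the next element of the list `z` otherwise. Returns
the resulting number and the unused part of the list. -/
def completeDigits (d : ℕ → Option ℕ) (a : ℕ) (z : List Bool) (s : ℕ) : ℕ × List Bool :=
  Nat.rec (a, z) (fun k q => (2 * q.1 + (d k).getD q.2.headI.toNat,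
    Option.casesOn (d k) q.2.tail fun _ => q.2)) s

theorem Computable.completeDigits {α : Type*} [Primcodable α] {d : α → ℕ → Option ℕ} {a : α → ℕ}
    {z : α → List Bool} {s : α → ℕ} (hd : Computable₂ d) (ha : Computable a) (hz : Computable z)
    (hs : Computable s) : Computable fun x => completeDigits (d x) (a x) (z x) (s x) := by
  have hdk : Computable fun p : α × ℕ × ℕ × List Bool => d p.1 p.2.1 :=
    hd.comp fst (fst.comp snd)
  have hq : Computable fun p : α × ℕ × ℕ × List Bool => p.2.2 := snd.comp snd
  have hb : Computable fun p : α × ℕ × ℕ × List Bool => p.2.2.2.headI.toNat :=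
    (Primrec.dom_bool Bool.toNat).to_comp.comp
      (Primrec.list_headI.to_comp.comp (snd.comp hq))
  have htail : Computable fun p : α × ℕ × ℕ × List Bool =>
      (Option.casesOn (d p.1 p.2.1) p.2.2.2.tail fun _ => p.2.2.2 : List Bool) :=
    option_casesOn hdk (Primrec.list_tail.to_comp.comp (snd.comp hq))
      (Computable.to₂ ((snd.comp hq).comp fst))
  have hstep : Computable₂ fun (x : α) (q : ℕ × ℕ × List Bool) =>
      ((2 * q.2.1 + (d x q.1).getD q.2.2.headI.toNat,
        Option.casesOn (d x q.1) q.2.2.tail fun _ => q.2.2) : ℕ × List Bool) :=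
    Computable.pair (nat_add (nat_mul (const 2) (fst.comp hq)) (option_getD hdk hb)) htail
  exact nat_rec hs (ha.pair hz) hstep

/-! ### Computability of the approximations, in integer arithmetic. -/

namespace BitComputer

open Computable

variable (U : BitComputer)

theorem computable_step : Computable U.step := by
  have hread : Computable fun c : ℕ × List Bool =>
      c.2.head?.map fun b => (U.next c.1 (some b), c.2.tail) :=
    option_map (Primrec.list_head?.to_comp.comp snd)
      (Computable.pair (U.computable_next.comp (fst.comp fst) (option_some.comp snd))
        (Primrec.list_tail.to_comp.comp (snd.comp fst))).to₂
  refine (cond (Primrec.option_isSome.to_comp.comp (U.computable_result.comp fst)) option_some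
    (cond (U.computable_reads.comp fst) hread (option_some.comp (Computable.pair
      (U.computable_next.comp fst (const none)) snd)))).of_eq ?_
  rintro ⟨σ, w⟩
  simp only [step]
  cases (U.result σ).isSome <;> cases U.reads σ <;> cases w <;> rfl

theorem computable_run : Computable₂ U.run := by
  have hstep : Computable₂ fun (_ : List Bool × ℕ) (q : ℕ × Option (ℕ × List Bool)) =>
      q.2.bind U.step :=
    option_bind (snd.comp snd) (U.computable_step.comp snd).to₂
  refine (nat_rec snd (option_some.comp (Computable.pair (const U.start) fst)) hstep).of_eq ?_
  rintro ⟨p, n⟩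
  simp only
  induction n with
  | zero => rfl
  | succ n ih => rw [run_succ, ← ih]

theorem computable_outputAt : Computable₂ U.outputAt := by
  have h : Computable₂ fun (_ : List Bool × ℕ) (c : ℕ × List Bool) =>
      bif decide (c.2 = []) then U.result c.1 else none :=
    cond (decide_eq (snd.comp snd) (const [])) (U.computable_result.comp (fst.comp snd)) (const none)
  refine (option_bind U.computable_run h).of_eq fun q => ?_
  simp [outputAt, cond_eq_ite]

/-- Contribution of the program with code `i` to `2 ^ t` times the halting probability, as far as
it is known at stage `t`. -/
def weightAt (t i : ℕ) : ℕ :=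
  ((decode (α := List Bool) i).bind fun p => bif decide (encode p = i) then
    (U.outputAt p t).map fun _ => 2 ^ (t - p.length) else none).getD 0

/-- Length of the output of the program with code `i`, as far as it is known at stage `t`. -/
def outputLengthAt (t i : ℕ) : ℕ :=
  ((decode (α := List Bool) i).bind fun p => (U.outputAt p t).map List.length).getD 0

/-- A string longer than all outputs produced at stage `t`. -/
def freshString (t : ℕ) : List Bool :=
  List.replicate (∑ i ∈ Finset.range t, U.outputLengthAt t i + 1) true

theorem computable_weightAt : Computable₂ U.weightAt := by
  have hout : Computable fun q : (ℕ × ℕ) × List Bool => U.outputAt q.2 q.1.1 :=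
    U.computable_outputAt.comp snd (fst.comp fst)
  have hpow : Computable₂ fun (q : (ℕ × ℕ) × List Bool) (_ : List Bool) =>
      2 ^ (q.1.1 - q.2.length) :=
    two_pow (nat_sub (fst.comp (fst.comp fst)) (list_length.comp (snd.comp fst)))
  have hcond : Computable₂ fun (q : ℕ × ℕ) (p : List Bool) => bif decide (encode p = q.2) then
      (U.outputAt p q.1).map fun _ => 2 ^ (q.1 - p.length) else none :=
    cond (decide_eq (Computable.encode.comp snd) (snd.comp fst)) (option_map hout hpow)
      (const none)
  have hdec : Computable fun q : ℕ × ℕ => decode (α := List Bool) q.2 :=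
    Computable.decode.comp snd
  exact option_getD (option_bind hdec hcond) (const 0)

theorem computable_freshString : Computable U.freshString := by
  have hout : Computable fun q : (ℕ × ℕ) × List Bool => U.outputAt q.2 q.1.1 :=
    U.computable_outputAt.comp snd (fst.comp fst)
  have hlen : Computable₂ fun (_ : (ℕ × ℕ) × List Bool) (x : List Bool) => x.length :=
    list_length.comp snd
  have hmap : Computable₂ fun (q : ℕ × ℕ) (p : List Bool) =>
      (U.outputAt p q.1).map List.length := option_map hout hlen
  have hdec : Computable fun q : ℕ × ℕ => decode (α := List Bool) q.2 :=
    Computable.decode.comp snd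
  have h : Computable₂ U.outputLengthAt := option_getD (option_bind hdec hmap) (const 0)
  exact list_replicate (nat_add (sum_range Computable.id h) (const 1)) true

/-- `2 ^ t` times the approximation of the halting probability at stage `t`. -/
def weight (t : ℕ) : ℕ := ∑ i ∈ Finset.range t, U.weightAt t i

theorem computable_weight : Computable U.weight := sum_range Computable.id U.computable_weightAt

theorem weight_eq (t : ℕ) : (U.weight t : ℝ) = 2 ^ t * U.omegaAt t := by
  classical
  have hsub : (U.haltedBy_finite t).toFinset.image encode ⊆ Finset.range t := fun i hi => by
    obtain ⟨p, hp, rfl⟩ := Finset.mem_image.1 hi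
    exact Finset.mem_range.2 ((U.haltedBy_finite t).mem_toFinset.1 hp).1
  rw [weight, ← Finset.sum_subset hsub, Finset.sum_image encode_injective.injOn, omegaAt,
    Finset.mul_sum, Nat.cast_sum]
  · refine Finset.sum_congr rfl fun p hp => ?_
    obtain ⟨hp, hp'⟩ := (U.haltedBy_finite t).mem_toFinset.1 hp
    obtain ⟨x, hx⟩ := Option.isSome_iff_exists.1 hp'
    -- Hence the subtraction `t - p.length` in `weightAt` is not truncated.
    have hlen : p.length ≤ t := (length_le_encode p).trans hp.le
    simp only [weightAt, encodek, Option.bind_some, decide_true, cond_true, hx, Option.map_some,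
      Option.getD_some]
    rw [Nat.cast_pow, Nat.cast_ofNat, pow_sub₀ _ two_ne_zero hlen, one_div, inv_pow]
  · intro i hi hi'
    rw [weightAt]
    cases h : decode (α := List Bool) i with
    | none => rfl
    | some p =>
      -- The test in `weightAt` discards numbers that decode to `p` without being its code, so that
      -- no program is counted twice.
      by_cases hpi : encode p = i
      · subst hpi
        cases hx : U.outputAt p t with
        | none => simp [hx]
        | some x =>
          refine absurd (Finset.mem_image_of_mem _ ?_) hi'
          exact (U.haltedBy_finite t).mem_toFinset.2 ⟨Finset.mem_range.1 hi, by simp [hx]⟩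
      · simp [hpi]

/-- The sum of all the lengths bounds each of them; overcounting does no harm. -/
theorem length_lt_freshString {t : ℕ} {p x : List Bool} (hp : p ∈ U.haltedBy t)
    (hx : U.outputAt p t = some x) : x.length < (U.freshString t).length := by
  rw [freshString, List.length_replicate, Nat.lt_succ_iff]
  have : x.length = U.outputLengthAt t (encode p) := by
    simp [outputLengthAt, hx]
  rw [this]
  exact Finset.single_le_sum (f := U.outputLengthAt t) (fun _ _ => Nat.zero_le _)
    (Finset.mem_range.2 hp.1)

/-- The string displayed at time `i`. -/
def displayAt (v : List Bool) (i : ℕ) : Option (List Bool) :=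
  (U.run v i).bind fun c => U.display c.1

/-- How often `x` is displayed during the first `s` steps. -/
def displayCount (v : List Bool) (s : ℕ) (x : List Bool) : ℕ :=
  ∑ i ∈ Finset.range (s + 1), bif decide (U.displayAt v i = some x) then 1 else 0

/-- A count stands in for the bounded search, so that `Computable.sum_range` makes it computable. -/
theorem displayCount_pos {v x : List Bool} {s : ℕ} :
    0 < U.displayCount v s x ↔ ∃ i ≤ s, U.displayAt v i = some x := by
  rw [displayCount, Finset.sum_pos_iff]
  refine exists_congr fun i => and_congr (by simp) ?_
  by_cases h : U.displayAt v i = some x <;> simp [h]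

variable (B : ℕ → Fin 2 → List Bool)

/-- The `k`-th bit, as far as it is known from the sentences displayed during the first `s` steps
on the program `v`. -/
def knownBit (v : List Bool) (s k : ℕ) : Option ℕ :=
  bif decide (0 < U.displayCount v s (B k 1)) then some 1 else
    bif decide (0 < U.displayCount v s (B k 0)) then some 0 else none

/-- The number of positions below `s` at which the bit is known after `s` steps. -/
def knownCount (v : List Bool) (s : ℕ) : ℕ :=
  ∑ k ∈ Finset.range s, bif (U.knownBit B v s k).isSome then 1 else 0

variable {B}

theorem computable_displayAt : Computable₂ U.displayAt := by
  have h : Computable₂ fun (_ : List Bool × ℕ) (c : ℕ × List Bool) => U.display c.1 :=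
    U.computable_display.comp (fst.comp snd)
  exact option_bind U.computable_run h

theorem computable_displayCount :
    Computable₂ fun (q : List Bool × ℕ) x => U.displayCount q.1 q.2 x := by
  have hat : Computable fun q : ((List Bool × ℕ) × List Bool) × ℕ => U.displayAt q.1.1.1 q.2 :=
    U.computable_displayAt.comp (fst.comp (fst.comp fst)) snd
  have hx : Computable fun q : ((List Bool × ℕ) × List Bool) × ℕ => some q.1.2 :=
    option_some.comp (snd.comp fst)
  have hterm : Computable₂ fun (q : (List Bool × ℕ) × List Bool) (i : ℕ) =>
      bif decide (U.displayAt q.1.1 i = some q.2) then 1 else 0 :=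
    cond (decide_eq hat hx) (const 1) (const 0)
  exact sum_range (nat_add (snd.comp fst) (const 1)) hterm

theorem computable_knownBit (hB : Computable₂ B) :
    Computable₂ fun (q : List Bool × ℕ) k => U.knownBit B q.1 q.2 k := by
  have h (b : Fin 2) : Computable fun q : (List Bool × ℕ) × ℕ =>
      decide (0 < U.displayCount q.1.1 q.1.2 (B q.2 b)) :=
    decide_lt (const 0) (U.computable_displayCount.comp fst (hB.comp snd (const b)))
  exact cond (h 1) (const (some 1)) (cond (h 0) (const (some 0)) (const none))

theorem computable_knownCount (hB : Computable₂ B) : Computable₂ (U.knownCount B) := by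
  have hterm : Computable₂ fun (q : List Bool × ℕ) (k : ℕ) =>
      bif (U.knownBit B q.1 q.2 k).isSome then 1 else 0 :=
    cond (Primrec.option_isSome.to_comp.comp (U.computable_knownBit hB)) (const 1) (const 0)
  exact sum_range snd hterm

/-! ### The diagonal computer. -/

variable (B)

/-- After `s` steps on `v`, at least `2 * c + 2` more bits are known than have been read. -/
def surplus (c : ℕ) (v : List Bool) (s : ℕ) : Bool :=
  ((U.run v s).map fun q =>
    decide (v.length + (2 * c + 2) ≤ U.knownCount B v s + q.2.length)).getD false

/-- The unread part of `v` after `s` steps supplies exactly the unknown bits below `s`, and with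
the number `a` before the binary point the resulting dyadic number exceeds the approximation of the
halting probability at stage `t` by less than `2 ^ (-s)`. -/
def attained (a : ℕ) (v : List Bool) (s t : ℕ) : Bool :=
  ((U.run v s).map fun q => decide (q.2.length + U.knownCount B v s = s) &&
    decide ((completeDigits (U.knownBit B v s) a q.2 s).1 * 2 ^ t <
      2 ^ s * U.weight t + 2 ^ t)).getD false

/-- On input `1 ^ c 0 v`, wait until the theory enumerated by `v` has a surplus of known bits,
complete them by the unread part of `v`, wait until the approximation of the halting probability
is as good as these bits say, and produce a string different from all outputs found so far. -/
def diagonal (a : ℕ) : List Bool →. List Bool := fun w =>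
  (Nat.rfind fun s => Part.some (U.surplus B (w.idxOf false) (w.drop (w.idxOf false + 1)) s)).bind
    fun s => (Nat.rfind fun t => Part.some (decide (w.idxOf false < w.length) &&
      U.attained B a (w.drop (w.idxOf false + 1)) s t)).map U.freshString

variable {B}

theorem computable_surplus (hB : Computable₂ B) :
    Computable₂ fun (q : ℕ × List Bool) s => U.surplus B q.1 q.2 s := by
  have hrun : Computable fun q : (ℕ × List Bool) × ℕ => U.run q.1.2 q.2 :=
    U.computable_run.comp (snd.comp fst) snd
  have hcount : Computable fun q : (ℕ × List Bool) × ℕ => U.knownCount B q.1.2 q.2 :=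
    (U.computable_knownCount hB).comp (snd.comp fst) snd
  have hbound : Computable fun q : (ℕ × List Bool) × ℕ => q.1.2.length + (2 * q.1.1 + 2) :=
    nat_add (list_length.comp (snd.comp fst))
      (nat_add (nat_mul (const 2) (fst.comp fst)) (const 2))
  have htest : Computable₂ fun (q : (ℕ × List Bool) × ℕ) (c : ℕ × List Bool) =>
      decide (q.1.2.length + (2 * q.1.1 + 2) ≤ U.knownCount B q.1.2 q.2 + c.2.length) :=
    decide_le (hbound.comp fst) (nat_add (hcount.comp fst) (list_length.comp (snd.comp snd)))
  exact option_getD (option_map hrun htest) (const false)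

theorem computable_attained (hB : Computable₂ B) (a : ℕ) :
    Computable₂ fun (q : List Bool × ℕ) t => U.attained B a q.1 q.2 t := by
  have hrun : Computable fun q : (List Bool × ℕ) × ℕ => U.run q.1.1 q.1.2 :=
    U.computable_run.comp (fst.comp fst) (snd.comp fst)
  have hvs : Computable fun q : ((List Bool × ℕ) × ℕ) × ℕ × List Bool => q.1.1 := fst.comp fst
  have ht : Computable fun q : ((List Bool × ℕ) × ℕ) × ℕ × List Bool => q.1.2 := snd.comp fst
  have hs : Computable fun q : ((List Bool × ℕ) × ℕ) × ℕ × List Bool => q.1.1.2 := snd.comp hvs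
  have hrest : Computable fun q : ((List Bool × ℕ) × ℕ) × ℕ × List Bool => q.2.2 := snd.comp snd
  have hcount : Computable fun q : ((List Bool × ℕ) × ℕ) × ℕ × List Bool =>
      U.knownCount B q.1.1.1 q.1.1.2 := (U.computable_knownCount hB).comp (fst.comp hvs) hs
  have hbit : Computable₂ fun (q : ((List Bool × ℕ) × ℕ) × ℕ × List Bool) (k : ℕ) =>
      U.knownBit B q.1.1.1 q.1.1.2 k :=
    (U.computable_knownBit hB).comp (hvs.comp fst) snd
  have hfill : Computable fun q : ((List Bool × ℕ) × ℕ) × ℕ × List Bool =>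
      completeDigits (U.knownBit B q.1.1.1 q.1.1.2) a q.2.2 q.1.1.2 :=
    Computable.completeDigits hbit (const a) hrest hs
  have htest : Computable₂ fun (q : (List Bool × ℕ) × ℕ) (c : ℕ × List Bool) =>
      decide (c.2.length + U.knownCount B q.1.1 q.1.2 = q.1.2) &&
        decide ((completeDigits (U.knownBit B q.1.1 q.1.2) a c.2 q.1.2).1 * 2 ^ q.2 <
          2 ^ q.1.2 * U.weight q.2 + 2 ^ q.2) :=
    bool_and (decide_eq (nat_add (list_length.comp hrest) hcount) hs)
      (decide_lt (nat_mul (fst.comp hfill) (two_pow ht))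
        (nat_add (nat_mul (two_pow hs) (U.computable_weight.comp ht)) (two_pow ht)))
  exact option_getD (option_map hrun htest) (const false)

section

attribute [local irreducible] surplus attained

theorem partrec_diagonal (hB : Computable₂ B) (a : ℕ) : Partrec (U.diagonal B a) := by
  have hc : Computable fun w : List Bool => w.idxOf false :=
    Primrec.list_idxOf.to_comp.comp (const false) Computable.id
  have hv : Computable fun w : List Bool => w.drop (w.idxOf false + 1) :=
    Primrec.list_drop.to_comp.comp (nat_add hc (const 1)) Computable.id
  have hcv : Computable fun w : List Bool => (w.idxOf false, w.drop (w.idxOf false + 1)) :=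
    hc.pair hv
  have hvs : Computable fun q : List Bool × ℕ => (q.1.drop (q.1.idxOf false + 1), q.2) :=
    (hv.comp fst).pair snd
  have h1 : Computable₂ fun (w : List Bool) s =>
      U.surplus B (w.idxOf false) (w.drop (w.idxOf false + 1)) s :=
    (U.computable_surplus hB).comp (hcv.comp fst) snd
  have h2 : Computable₂ fun (q : List Bool × ℕ) t => decide (q.1.idxOf false < q.1.length) &&
      U.attained B a (q.1.drop (q.1.idxOf false + 1)) q.2 t :=
    bool_and (decide_lt (hc.comp (fst.comp fst)) (list_length.comp (fst.comp fst)))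
      ((U.computable_attained hB a).comp (hvs.comp fst) snd)
  have h3 : Partrec₂ fun (w : List Bool) (s : ℕ) => (Nat.rfind fun t =>
      Part.some (decide (w.idxOf false < w.length) &&
        U.attained B a (w.drop (w.idxOf false + 1)) s t)).map U.freshString :=
    (Partrec.rfind h2.partrec₂).map (U.computable_freshString.comp snd).to₂
  exact (Partrec.rfind h1.partrec₂).bind h3

end

end BitComputer

/-! ### Binary digits. -/

/-- Halving the left-hand floor drops its last bit, which is digit `s`. Digits are read off from
floors, so dyadic `x` causes no ambiguity. -/
theorem Real.floor_mul_two_pow_succ (x : ℝ) (s : ℕ) :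
    ⌊x * 2 ^ (s + 1)⌋₊ = 2 * ⌊x * 2 ^ s⌋₊ + (Real.digits x 2 s : ℕ) := by
  have h : ⌊x * 2 ^ s⌋₊ = ⌊x * 2 ^ (s + 1)⌋₊ / 2 := by
    rw [← Nat.floor_div_natCast, pow_succ]
    congr 1
    push_cast
    ring
  have h' : (Real.digits x 2 s : ℕ) = ⌊x * 2 ^ (s + 1)⌋₊ % 2 := by
    simp [Real.digits]
  omega

/-- Partial knowledge of the binary digits of `x` can be completed by as many bits as there are
unknown digits. -/
theorem exists_completeDigits_eq (x : ℝ) (d : ℕ → Option ℕ)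
    (hd : ∀ k b, d k = some b → b = (Real.digits x 2 k : ℕ)) (s : ℕ) :
    ∃ z : List Bool, z.length + ∑ k ∈ Finset.range s, (bif (d k).isSome then 1 else 0) = s ∧
      ∀ r, completeDigits d ⌊x⌋₊ (z ++ r) s = (⌊x * 2 ^ s⌋₊, r) := by
  induction s with
  | zero => exact ⟨[], by simp, fun r => by simp [completeDigits]⟩
  | succ s ih =>
    obtain ⟨z, hz, h⟩ := ih
    have hsucc (z : List Bool) : completeDigits d ⌊x⌋₊ z (s + 1) =
        (2 * (completeDigits d ⌊x⌋₊ z s).1 +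
          (d s).getD (completeDigits d ⌊x⌋₊ z s).2.headI.toNat,
        Option.casesOn (d s) (completeDigits d ⌊x⌋₊ z s).2.tail
          fun _ => (completeDigits d ⌊x⌋₊ z s).2) := rfl
    cases hds : d s with
    | some b =>
      refine ⟨z, by simp [Finset.sum_range_succ, hds, ← add_assoc, hz], fun r => ?_⟩
      rw [hsucc, h, hds, Real.floor_mul_two_pow_succ, hd s b hds]
      rfl
    | none =>
      refine ⟨z ++ [decide ((Real.digits x 2 s : ℕ) = 1)], ?_, fun r => ?_⟩
      · simp only [List.length_append, List.length_singleton, Finset.sum_range_succ, hds,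
          Option.isSome_none, cond_false]
        omega
      · rw [hsucc, List.append_assoc, h, hds, Real.floor_mul_two_pow_succ]
        have := (Real.digits x 2 s).isLt
        simp only [List.singleton_append, List.headI_cons, List.tail_cons, Option.getD_none,
          Prod.mk.injEq, and_true, Nat.add_left_cancel_iff]
        by_cases h1 : (Real.digits x 2 s : ℕ) = 1
        · simp [h1]
        · simp only [h1, decide_false, Bool.toNat_false]
          omega

/-! ### Behaviour of the diagonal computer. -/

namespace BitComputer

variable (U : BitComputer) {B : ℕ → Fin 2 → List Bool}

theorem knownBit_congr {v v' : List Bool} {s : ℕ}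
    (h : ∀ i ≤ s, U.displayAt v i = U.displayAt v' i) : U.knownBit B v s = U.knownBit B v' s := by
  have hcount (x : List Bool) : U.displayCount v s x = U.displayCount v' s x :=
    Finset.sum_congr rfl fun i hi => by
      rw [h i (Nat.lt_succ_iff.1 (Finset.mem_range.1 hi))]
  funext k
  simp only [knownBit, hcount]

theorem knownCount_congr {v v' : List Bool} {s : ℕ}
    (h : ∀ i ≤ s, U.displayAt v i = U.displayAt v' i) :
    U.knownCount B v s = U.knownCount B v' s := by
  simp only [knownCount, U.knownBit_congr h]

theorem displayAt_append_congr {p : List Bool} {s : ℕ}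
    (h : ∀ i ≤ s, ∃ τ u, ∀ r, U.run (p ++ r) i = some (τ, u ++ r)) (r r' : List Bool) :
    ∀ i ≤ s, U.displayAt (p ++ r) i = U.displayAt (p ++ r') i := fun i hi => by
  obtain ⟨τ, u, hu⟩ := h i hi
  simp only [displayAt, hu, Option.bind_some]

/-- The test compares the known bits with `v.length - rest.length`, the number of bits read, so it
cannot depend on the unread part. -/
theorem surplus_append_congr {p : List Bool} {s : ℕ}
    (h : ∀ i ≤ s, ∃ τ u, ∀ r, U.run (p ++ r) i = some (τ, u ++ r)) (c : ℕ)
    (r r' : List Bool) {i : ℕ} (hi : i ≤ s) :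
    U.surplus B c (p ++ r) i = U.surplus B c (p ++ r') i := by
  obtain ⟨τ, u, hu⟩ := h i hi
  have := U.knownCount_congr (B := B) fun j hj =>
    U.displayAt_append_congr h r r' j (hj.trans hi)
  simp only [surplus, hu, this, Option.map_some, Option.getD_some, List.length_append,
    decide_eq_decide]
  omega

theorem surplus_eq_true {c : ℕ} {v : List Bool} {s : ℕ} : U.surplus B c v s = true ↔
    ∃ σ rest, U.run v s = some (σ, rest) ∧
      v.length + (2 * c + 2) ≤ U.knownCount B v s + rest.length := by
  rw [surplus]
  cases h : U.run v s with
  | none => simp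
  | some q =>
    obtain ⟨σ, rest⟩ := q
    simp

theorem attained_eq_true {a : ℕ} {v : List Bool} {s t : ℕ} : U.attained B a v s t = true ↔
    ∃ σ rest, U.run v s = some (σ, rest) ∧ rest.length + U.knownCount B v s = s ∧
      (completeDigits (U.knownBit B v s) a rest s).1 * 2 ^ t < 2 ^ s * U.weight t + 2 ^ t := by
  rw [attained]
  cases h : U.run v s with
  | none => simp
  | some q =>
    obtain ⟨σ, rest⟩ := q
    simp

theorem mem_diagonal {a : ℕ} {w x : List Bool} : x ∈ U.diagonal B a w ↔
    ∃ s t, (U.surplus B (w.idxOf false) (w.drop (w.idxOf false + 1)) s = true ∧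
        ∀ i < s, U.surplus B (w.idxOf false) (w.drop (w.idxOf false + 1)) i = false) ∧
      (t ∈ Nat.rfind fun t => Part.some (decide (w.idxOf false < w.length) &&
        U.attained B a (w.drop (w.idxOf false + 1)) s t)) ∧ U.freshString t = x := by
  simp only [diagonal, Part.mem_bind_iff, Part.mem_map_iff]
  constructor
  · rintro ⟨s, hs, t, ht, hx⟩
    have hs := Nat.mem_rfind.1 hs
    exact ⟨s, t, ⟨(Part.mem_some_iff.1 hs.1).symm,
      fun i hi => (Part.mem_some_iff.1 (hs.2 hi)).symm⟩, ht, hx⟩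
  · rintro ⟨s, t, hs, ht, hx⟩
    exact ⟨s, Nat.mem_rfind.2 ⟨Part.mem_some_iff.2 hs.1.symm,
      fun hi => Part.mem_some_iff.2 (hs.2 _ hi).symm⟩, t, ht, hx⟩

/-- Both inputs have the same header, hence the same `c`, and reach their first surplus at the same
time `s`, having read the same bits. Both unread parts then have length `s` minus the same count, so
the extension adds nothing. -/
theorem diagonal_prefixFree {a : ℕ} {w w' : List Bool} (hw : (U.diagonal B a w).Dom)
    (hw' : (U.diagonal B a w').Dom) (hww' : w <+: w') : w = w' := by
  obtain ⟨x, hx⟩ := Part.dom_iff_mem.1 hw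
  obtain ⟨x', hx'⟩ := Part.dom_iff_mem.1 hw'
  obtain ⟨s, t, ⟨hs, hmin⟩, ht, -⟩ := U.mem_diagonal.1 hx
  obtain ⟨s', t', ⟨hs', hmin'⟩, ht', -⟩ := U.mem_diagonal.1 hx'
  obtain ⟨r, rfl⟩ := hww'
  have ht := (Part.mem_some_iff.1 (Nat.rfind_spec ht)).symm
  have ht' := (Part.mem_some_iff.1 (Nat.rfind_spec ht')).symm
  rw [Bool.and_eq_true, decide_eq_true_iff] at ht ht'
  -- The check that `false` occurs in `w` ensures that the header is complete.
  have hidx : (w ++ r).idxOf false = w.idxOf false :=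
    List.idxOf_append_of_mem (List.idxOf_lt_length_iff.1 ht.1)
  rw [hidx, List.drop_append_of_le_length ht.1] at hs' hmin' ht'
  generalize w.idxOf false = c at *
  generalize w.drop (c + 1) = v at *
  obtain ⟨σ, rest, hrun, hcount, -⟩ := U.attained_eq_true.1 ht.2
  obtain ⟨p, rfl, hlast, hpre⟩ := U.exists_read_prefix hrun
  rw [List.append_assoc] at hs' hmin' ht'
  have hcongr {i : ℕ} (hi : i ≤ s) := U.surplus_append_congr (B := B) hpre c rest (rest ++ r) hi
  obtain rfl : s = s' := by
    rcases lt_trichotomy s s' with hlt | heq | hlt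
    · have := hmin' s hlt
      rw [← hcongr le_rfl, hs] at this
      cases this
    · exact heq
    · have := hmin s' hlt
      rw [hcongr hlt.le, hs'] at this
      cases this
  obtain ⟨σ', rest', hrun', hcount', -⟩ := U.attained_eq_true.1 ht'.2
  rw [hlast] at hrun'
  simp only [Option.some.injEq, Prod.mk.injEq] at hrun'
  obtain ⟨-, rfl⟩ := hrun'
  rw [← U.knownCount_congr (U.displayAt_append_congr hpre rest (rest ++ r)),
    List.length_append] at hcount'
  have : r = [] := List.length_eq_zero_iff.1 (by omega)
  simp [this]

theorem isSelfDelimiting_diagonal (hB : Computable₂ B) (a : ℕ) :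
    IsSelfDelimiting (U.diagonal B a) :=
  ⟨U.partrec_diagonal hB a, fun _ _ => U.diagonal_prefixFree⟩

theorem omega_nonneg : 0 ≤ U.omega := tsum_nonneg fun _ => by positivity

/-- If a program yields more correct bits of the halting probability than it has itself, then the
diagonal computer, on a short input, finds a stage with a good approximation of the halting
probability. -/
theorem exists_mem_diagonal {c : ℕ} {p : List Bool} (hp : ∃ s, U.surplus B c p s = true)
    (hbit : ∀ s k b, U.knownBit B p s k = some b → b = (Real.digits U.omega 2 k : ℕ)) :
    ∃ w s t, U.freshString t ∈ U.diagonal B ⌊U.omega⌋₊ w ∧ w.length + c + 1 ≤ s ∧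
      U.omega < U.omegaAt t + 2 * (1 / 2) ^ s := by
  classical
  set s := Nat.find hp
  have hs : U.surplus B c p s = true := Nat.find_spec hp
  have hmin : ∀ i < s, U.surplus B c p i = false := fun i hi => by
    simpa using Nat.find_min hp hi
  clear_value s
  obtain ⟨σ, rest, hrun, hcount⟩ := U.surplus_eq_true.1 hs
  -- Only the part `q` read so far is kept; the unread `rest` is replaced by the missing digits `z`.
  obtain ⟨q, rfl, hlast, hpre⟩ := U.exists_read_prefix hrun
  obtain ⟨z, hz, hdigits⟩ := exists_completeDigits_eq U.omega _ (hbit s) s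
  have hdisp := U.displayAt_append_congr hpre rest z
  have hkz : z.length + U.knownCount B (q ++ z) s = s := by
    rw [← U.knownCount_congr hdisp]
    exact hz
  have hcz (t : ℕ) : U.attained B ⌊U.omega⌋₊ (q ++ z) s t = true ↔
      ⌊U.omega * 2 ^ s⌋₊ * 2 ^ t < 2 ^ s * U.weight t + 2 ^ t := by
    have hd : (completeDigits (U.knownBit B (q ++ z) s) ⌊U.omega⌋₊ z s).1 =
        ⌊U.omega * 2 ^ s⌋₊ := by
      have := hdigits []
      rw [List.append_nil, U.knownBit_congr hdisp] at this
      rw [this]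
    rw [attained_eq_true]
    constructor
    · rintro ⟨σ', rest', hrun', -, h⟩
      rw [hlast] at hrun'
      simp only [Option.some.injEq, Prod.mk.injEq] at hrun'
      obtain ⟨-, rfl⟩ := hrun'
      rwa [hd] at h
    · exact fun h => ⟨σ, z, hlast z, hkz, by rwa [hd]⟩
  have hreal (t : ℕ) : U.attained B ⌊U.omega⌋₊ (q ++ z) s t = true ↔
      (⌊U.omega * 2 ^ s⌋₊ : ℝ) < 2 ^ s * U.omegaAt t + 1 := by
    rw [hcz, ← Nat.cast_lt (α := ℝ)]
    push_cast
    rw [U.weight_eq, show (2 : ℝ) ^ s * (2 ^ t * U.omegaAt t) + 2 ^ t =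
      (2 ^ s * U.omegaAt t + 1) * 2 ^ t by ring]
    exact mul_lt_mul_iff_left₀ (by positivity)
  have hpow : (2 : ℝ) ^ s * (1 / 2) ^ s = 1 := by
    rw [← mul_pow]
    norm_num
  have hpos : (0 : ℝ) < 2 ^ s := by positivity
  obtain ⟨t₀, ht₀⟩ := U.exists_lt_omegaAt (ε := (1 / 2) ^ s) (by positivity)
  have hatt : U.attained B ⌊U.omega⌋₊ (q ++ z) s t₀ = true := by
    rw [hreal]
    have h1 := Nat.floor_le (mul_nonneg U.omega_nonneg hpos.le)
    have h2 := mul_lt_mul_of_pos_left ht₀ hpos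
    rw [mul_add, hpow] at h2
    linarith
  set w := List.replicate c true ++ false :: (q ++ z) with hw
  have hidx : w.idxOf false = c := by
    rw [hw, List.idxOf_append_of_notMem (by simp [List.mem_replicate])]
    simp
  have hdrop : w.drop (c + 1) = q ++ z := by
    rw [hw, List.drop_append, List.drop_of_length_le (by simp)]
    simp
  have hlt : c < w.length := by simp [hw]
  obtain ⟨t, ht, -⟩ := Nat.rfind_min' (p := fun t => decide (w.idxOf false < w.length) &&
    U.attained B ⌊U.omega⌋₊ (w.drop (w.idxOf false + 1)) s t) (m := t₀)
    (by simp [hidx, hdrop, hlt, hatt])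
  refine ⟨w, s, t, U.mem_diagonal.2 ⟨s, t, ⟨?_, fun i hi => ?_⟩, ht, rfl⟩, ?_, ?_⟩
  · rw [hidx, hdrop, ← U.surplus_append_congr hpre c rest z le_rfl, hs]
  · rw [hidx, hdrop, ← U.surplus_append_congr hpre c rest z hi.le, hmin i hi]
  · have hlen : w.length = c + 1 + (q.length + z.length) := by
      simp [hw]
      ring
    rw [List.length_append] at hcount
    rw [← U.knownCount_congr hdisp] at hkz
    omega
  · have h := (Part.mem_some_iff.1 (Nat.rfind_spec ht)).symm
    rw [Bool.and_eq_true, hidx, hdrop] at h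
    -- One unit of `2 ^ (-s)` is lost in the test and one in truncating `Ω`.
    have h1 := (hreal t).1 h.2
    have h2 := Nat.lt_floor_add_one (U.omega * 2 ^ s)
    refine lt_of_mul_lt_mul_left ?_ hpos.le
    linear_combination h1 + h2 - 2 * hpow

/-- Before stage `t` all programs shorter than `s` that ever halt have halted, if the remaining
halting probability is less than `2 ^ (1 - s)`. -/
theorem le_complexity_freshString {s t : ℕ} (h : U.omega < U.omegaAt t + 2 * (1 / 2) ^ s) :
    (s : ℕ∞) ≤ complexity U.eval (U.freshString t) := by
  refine le_iInf₂ fun q hq => ?_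
  rw [Nat.cast_le]
  by_contra! hlt
  by_cases hqt : q ∈ U.haltedBy t
  · obtain ⟨y, hy⟩ := Option.isSome_iff_exists.1 hqt.2
    have : y = U.freshString t := Part.mem_unique (U.mem_eval.2 ⟨t, hy⟩) hq
    exact absurd (U.length_lt_freshString hqt hy) (by rw [this]; exact lt_irrefl _)
  · have h1 := U.omegaAt_add_le (Part.dom_iff_mem.2 ⟨_, hq⟩) hqt
    -- Here `1 ≤ s`, as `q` is shorter than `s`. The missing weight of `q` alone is at least `2 * (1
    -- / 2) ^ s`.
    have h2 : (1 / 2 : ℝ) ^ (s - 1) ≤ (1 / 2) ^ q.length :=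
      pow_le_pow_of_le_one (by norm_num) (by norm_num) (by omega)
    have h3 : (1 / 2 : ℝ) ^ s = (1 / 2) ^ (s - 1) * (1 / 2) := by
      rw [← pow_succ]
      congr 1
      omega
    linarith

/-- A program enumerating a theory that settles enough bits eventually has a surplus of bits. -/
theorem Enumerates.exists_surplus {p : List Bool} {T : Set (List Bool)} (hp : U.Enumerates p T)
    {c : ℕ} (h : ((p.length + (2 * c + 2) : ℕ) : ℕ∞) ≤ {k : ℕ | ∃ b, B k b ∈ T}.encard) :
    ∃ s, U.surplus B c p s = true := by
  obtain ⟨K, hK, hcard⟩ := Set.exists_subset_encard_eq h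
  have hfin : K.Finite := Set.finite_of_encard_eq_coe hcard
  lift K to Finset ℕ using hfin
  rw [Set.encard_coe_eq_coe_finsetCard, Nat.cast_inj] at hcard
  have htime : ∀ k : ℕ, ∃ n, k ∈ K → ∃ b, U.displayAt p n = some (B k b) := fun k => by
    by_cases hk : k ∈ K
    · obtain ⟨b, hb⟩ := hK hk
      obtain ⟨n, σ, w, hrun, hdisp⟩ := (hp.2.2 _).2 hb
      exact ⟨n, fun _ => ⟨b, by simp [displayAt, hrun, hdisp]⟩⟩
    · exact ⟨0, fun h => absurd h hk⟩
  choose n hn using htime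
  -- Late enough for each position in `K` to lie below `s` and for its sentence to have been
  -- displayed.
  set s := K.sup fun k => max (k + 1) (n k)
  have hle {k : ℕ} (hk : k ∈ K) : max (k + 1) (n k) ≤ s :=
    Finset.le_sup (f := fun k => max (k + 1) (n k)) hk
  obtain ⟨⟨σ, rest⟩, hrun⟩ := Option.ne_none_iff_exists'.1 (hp.1 s)
  refine ⟨s, U.surplus_eq_true.2 ⟨σ, rest, hrun, ?_⟩⟩
  have hcount : K.card ≤ U.knownCount B p s := by
    rw [Finset.card_eq_sum_ones]
    refine le_trans (Finset.sum_le_sum fun k hk => ?_) (Finset.sum_le_sum_of_subset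
      (f := fun k => bif (U.knownBit B p s k).isSome then 1 else 0)
      fun k hk => Finset.mem_range.2 ((le_max_left _ _).trans (hle hk)))
    obtain ⟨b, hb⟩ := hn k hk
    have hpos : 0 < U.displayCount p s (B k b) :=
      U.displayCount_pos.2 ⟨n k, (le_max_right _ _).trans (hle hk), hb⟩
    have hsome : (U.knownBit B p s k).isSome := by
      rw [knownBit]
      by_cases h1 : 0 < U.displayCount p s (B k 1)
      · simp [h1]
      · have h0 : 0 < U.displayCount p s (B k 0) := by
          fin_cases b
          · exact hpos
          · exact absurd hpos h1
        simp [h0, cond_eq_ite, h1]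
    simp [hsome]
  omega

/-- Known bits come from displayed sentences, so they are correct digits when all theorems are true.
-/
theorem displayed_of_knownBit {p : List Bool} {s k b : ℕ} (h : U.knownBit B p s k = some b) :
    ∃ b' : Fin 2, (b' : ℕ) = b ∧ U.Displays p (B k b') := by
  have hdisp {x : List Bool} (hx : 0 < U.displayCount p s x) : U.Displays p x := by
    obtain ⟨i, -, hi⟩ := U.displayCount_pos.1 hx
    obtain ⟨⟨σ, w⟩, h1, h2⟩ := Option.bind_eq_some_iff.1 hi
    exact ⟨i, σ, w, h1, h2⟩
  rw [knownBit] at h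
  by_cases h1 : 0 < U.displayCount p s (B k 1)
  · simp only [h1, decide_true, cond_true, Option.some.injEq] at h
    exact ⟨1, h, hdisp h1⟩
  · by_cases h0 : 0 < U.displayCount p s (B k 0)
    · simp only [h1, decide_false, cond_false, h0, decide_true, cond_true,
        Option.some.injEq] at h
      exact ⟨0, h, hdisp h0⟩
    · simp [h1, h0] at h

end BitComputer

/-! ### The incompleteness theorem. -/

theorem mainTheorem1 (U : BitComputer) (hU : U.IsUniversal)
    -- the true sentences of a language, and its sentences "bit `k` of `Ω` is `b`",
    -- where bit `0` is the first one after the binary point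
    (Truth : Set (List Bool)) (bitSentence : ℕ → Fin 2 → List Bool)
    (hcomp : Computable₂ bitSentence)
    (hbit : ∀ k b, bitSentence k b ∈ Truth ↔ Real.digits U.omega 2 k = b) :
    ∃ c : ℕ, ∀ (T : Set (List Bool)) (N : ℕ), T ⊆ Truth → U.theoryComplexity T = N →
      {k : ℕ | ∃ b, bitSentence k b ∈ T}.encard ≤ N + c := by
  obtain ⟨c, hc⟩ := hU _ (U.isSelfDelimiting_diagonal hcomp ⌊U.omega⌋₊)
  -- The header `1 ^ c 0` costs `c + 1` bits, the passage from `diagonal` to `U` another `c`.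
  refine ⟨2 * c + 1, fun T N hT hN => ?_⟩
  by_contra! hlt
  have hlt' : ((N + (2 * c + 2) : ℕ) : ℕ∞) ≤ {k : ℕ | ∃ b, bitSentence k b ∈ T}.encard := by
    have := Order.add_one_le_of_lt hlt
    refine le_trans (le_of_eq ?_) this
    push_cast
    ring
  obtain ⟨p, hp, hpN⟩ : ∃ p, U.Enumerates p T ∧ p.length ≤ N := by
    have h : U.theoryComplexity T < ((N + 1 : ℕ) : ℕ∞) := by
      rw [hN, Nat.cast_lt]
      exact Nat.lt_succ_self N
    simp only [BitComputer.theoryComplexity, iInf_lt_iff, Nat.cast_lt] at h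
    obtain ⟨p, hp, h⟩ := h
    exact ⟨p, hp, Nat.lt_succ_iff.1 h⟩
  obtain ⟨w, s, t, hw, hlen, hs⟩ := U.exists_mem_diagonal
    (BitComputer.Enumerates.exists_surplus U hp
      (le_trans (Nat.cast_le.2 (Nat.add_le_add_right hpN _)) hlt'))
    fun s k b hb => by
      obtain ⟨b', rfl, hdisp⟩ := U.displayed_of_knownBit hb
      rw [(hbit k b').1 (hT ((hp.2.2 _).1 hdisp))]
  -- The fresh string has complexity at least `s`, but `w` describes it within `w.length + c < s`
  -- bits.
  have h1 : (s : ℕ∞) ≤ ((w.length + c : ℕ) : ℕ∞) := by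
    refine (U.le_complexity_freshString hs).trans ((hc _).trans ?_)
    rw [Nat.cast_add]
    gcongr
    exact iInf₂_le w hw
  rw [Nat.cast_le] at h1
  omega
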